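/- All categories are locally small. Let $\mathcal U$ be a small preadditive category, $\mathcal C$ an abelian AB5 category (in particular cocomplete), and $T:\mathcal U\to\mathcal C$ an additive functor. **Notation.** For a small preadditive category $\mathcal G$, $\mathrm{Mod}(\mathcal G)$ is the category of additive functors $\mathcal G^{\mathrm{op}}\to\mathrm{Ab}$. For an additive functor $F:\mathcal G\to\mathcal A$ into a cocomplete abelian category, the *restriction functor* is $F_*:\mathcal A\to\mathrm{Mod}(\mathcal G)$, $F_*A=\mathcal A(F-,A)$, and the *induction functor* $F^*:\mathrm{Mod}(\mathcal G)\to\mathcal A$ is its left adjoint (the unique colimit-preserving functor, up to isomorphism, with $F^*\mathcal G(-,G)\cong FG$ naturally in $G$). $\operatorname{Ker}F^*$ is the full subcategory of modules annihilated by $F^*$. A *localizing subcategory* of $\mathrm{Mod}(\mathcal G)$ is a full subcategory closed under subobjects, quotients, extensions and (small) direct sums. For a full subcategory $\mathcal L$ of $\mathrm{Mod}(\mathcal G)$: - $F$ is *generalized $\mathcal L$-closed* if $F^*L=0$ for all $L\in\mathcal L$ and $F^*$ preserves the exactness of every short exact sequence $0\to M\to N\to L\to0$ with $L\in\mathcal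 L$; - a functor $S:\mathcal U\to\mathcal G$ is an *$\mathcal L$-conditioned epimorphism* if, for every cocomplete abelian category $\mathcal A$ and all additive functors $F,F':\mathcal G\to\mathcal A$ with $F$ generalized $\mathcal L$-closed, $F\circ S=F'\circ S$ implies $F=F'$. $T$ is a *generalized lax epimorphism* if $T_*:\mathcal C\to\mathrm{Mod}(\mathcal U)$ is fully faithful. The *canonical factorization* $T=I\circ S$, $\mathcal U\xrightarrow{S}\mathcal G\xrightarrow{I}\mathcal C$, is the one where $\mathcal G$ has the objects of $\mathcal U$ and morphisms $\mathcal G(U',U)=\mathcal C(TU',TU)$; $S$ is the identity on objects and acts as $T$ on morphisms, and $I$ acts as $T$ on objects and is the identity on morphisms (so $S$ is bijective on objects and $I$ is fully faithful). $\mathcal G$ *generates* $\mathcal C$ if the objects $IG$, $G\in\mathcal G$, form a generating family: whenever $f,g:X\to Y$ in $\mathcal C$ satisfy $fh=gh$ for all $G\in\mathcal G$ and all $h:IG\to X$, then $f=g$. **Theorem.** The functor $T$ is a generalized lax epimorphism if and only if the following two conditions hold: 1. $\mathcal G$ generates $\mathcal C$; 2. $S$ is a $\operatorname{Ker}I^*$-conditioned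 epimorphism. Moreover, if $\mathcal G$ generates $\mathcal C$, then $\operatorname{Ker}I^*$ is a localizing subcategory of $\mathrm{Mod}(\mathcal G)$ and $\mathcal C$ is a Grothendieck category. -/

import Mathlib

open CategoryTheory CategoryTheory.Limits Opposite ZeroObject

universe v w u

noncomputable section

namespace SeveralObjects

/-! ### Modules over a ring with several objects -/

section Closure

variable {J : Type u} [Category.{v} J] [Preadditive J]

lemma additive_of_mono {X Y : J ⥤ AddCommGrpCat.{v}} (f : X ⟶ Y) [Mono f] (hY : Y.Additive) :
    X.Additive where
  map_add {a b s t} := by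
    rw [← cancel_mono (f.app b)]
    simp [Preadditive.add_comp, Preadditive.comp_add]

lemma additive_of_epi {X Y : J ⥤ AddCommGrpCat.{v}} (f : X ⟶ Y) [Epi f] (hX : X.Additive) :
    Y.Additive where
  map_add {a b s t} := by
    rw [← cancel_epi (f.app a)]
    simp [← NatTrans.naturality, Preadditive.add_comp, Preadditive.comp_add]

instance : (additiveFunctor J AddCommGrpCat.{v}).ContainsZero where
  exists_zero := ⟨0, isZero_zero _,
    ⟨fun {_ _ _ _} => ((isZero_zero (J ⥤ AddCommGrpCat.{v})).obj _).eq_of_tgt _ _⟩⟩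

instance : (additiveFunctor J AddCommGrpCat.{v}).IsClosedUnderKernels where
  kernels_le := by
    rintro _ ⟨f, k, hk, hf, -⟩
    have : Mono k.ι := Fork.IsLimit.mono hk
    exact additive_of_mono k.ι hf

instance : (additiveFunctor J AddCommGrpCat.{v}).IsClosedUnderCokernels where
  cokernels_le := by
    rintro _ ⟨f, k, hk, -, hf⟩
    have : Epi k.π := Cofork.IsColimit.epi hk
    exact additive_of_epi k.π hf

instance : (additiveFunctor J AddCommGrpCat.{v}).IsClosedUnderFiniteProducts where
  isClosedUnderLimitsOfShape K _ := ⟨by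
    rintro X ⟨p⟩
    refine ⟨fun {a b s t} => ?_⟩
    refine (isLimitOfPreserves ((evaluation J AddCommGrpCat.{v}).obj b) p.isLimit).hom_ext
      fun j => ?_
    have : (p.diag.obj j).Additive := p.prop_diag_obj j
    simp [Preadditive.add_comp, Preadditive.comp_add]⟩

end Closure

/-- The category of (right) modules over a small preadditive category `G`:
additive functors from `Gᵒᵖ` to abelian groups. -/
abbrev Mod (G : Type v) [SmallCategory G] [Preadditive G] : Type (v + 1) :=
  Gᵒᵖ ⥤+ AddCommGrpCat.{v}

instance (G : Type v) [SmallCategory G] [Preadditive G] : Abelian (Mod G) := inferInstance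

section Restriction

variable {G : Type v} [SmallCategory G] [Preadditive G]
variable {A : Type w} [Category.{v} A] [Preadditive A]

/-- The restriction functor `F_* : A ⥤ Mod G`, `a ↦ A(F -, a)`, of an additive functor
`F : G ⥤ A`. -/
def restriction (F : G ⥤ A) [F.Additive] : A ⥤ Mod G :=
  (additiveFunctor Gᵒᵖ AddCommGrpCat.{v}).lift
    (preadditiveYoneda ⋙ (Functor.whiskeringLeft _ _ _).obj F.op)
    (fun a => inferInstanceAs (F.op ⋙ preadditiveYoneda.obj a).Additive)

instance (F : G ⥤ A) [F.Additive] : (restriction F).Additive where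
  map_add {a b f g} := by
    ext x y
    exact Preadditive.comp_add _ _ _ _ _ _

/-- `F` is a generalized lax epimorphism: its restriction functor is fully faithful. -/
def IsGeneralizedLaxEpi (F : G ⥤ A) [F.Additive] : Prop :=
  (restriction F).Full ∧ (restriction F).Faithful

end Restriction

/-! ### The induction functor -/

namespace Induction

variable {G : Type v} [SmallCategory G] [Preadditive G]
variable {A : Type w} [Category.{v} A] [Abelian A] [HasColimits A]
variable (F : G ⥤ A) (X : Mod G)

/-- Generators of the object `F^* X`: pairs `(g, x)` with `x ∈ X g`. -/
abbrev Gen : Type v := Σ g : G, X.obj.obj (op g)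

/-- Indices of the relations expressing additivity in `x`. -/
abbrev AddRel : Type v := Σ g : G, X.obj.obj (op g) × X.obj.obj (op g)

/-- Indices of the relations expressing naturality in `g`. -/
abbrev NatRel : Type v := Σ (p : G × G), (p.1 ⟶ p.2) × X.obj.obj (op p.2)

/-- The direct sum of the `F g`, over all `g` and `x ∈ X g`. -/
abbrev free : A := ∐ fun i : Gen X => F.obj i.1

/-- The inclusion of the summand with index `(g, x)`. -/
abbrev incl (g : G) (x : X.obj.obj (op g)) : F.obj g ⟶ free F X :=
  Sigma.ι (fun i : Gen X => F.obj i.1) ⟨g, x⟩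

/-- The relations `(x + y) = (x) + (y)`. -/
abbrev addRel : (∐ fun r : AddRel X => F.obj r.1) ⟶ free F X :=
  Sigma.desc fun r => incl F X r.1 (r.2.1 + r.2.2) - incl F X r.1 r.2.1 - incl F X r.1 r.2.2

/-- The relations identifying `(x)` composed with `F h` and `(X h x)`. -/
abbrev natRel : (∐ fun r : NatRel X => F.obj r.1.1) ⟶ free F X :=
  Sigma.desc fun r => incl F X r.1.1 (X.obj.map r.2.1.op r.2.2) -
    F.map r.2.1 ≫ incl F X r.1.2 r.2.2

/-- The object `F^* X`, i.e. the tensor product `X ⊗_G F`. -/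
def obj : A := cokernel (coprod.desc (addRel F X) (natRel F X))

/-- The structure maps `F g ⟶ F^* X`. -/
def ι (g : G) (x : X.obj.obj (op g)) : F.obj g ⟶ obj F X :=
  incl F X g x ≫ cokernel.π (coprod.desc (addRel F X) (natRel F X))

variable {F X}

lemma ι_add (g : G) (x y : X.obj.obj (op g)) : ι F X g (x + y) = ι F X g x + ι F X g y := by
  have h : addRel F X ≫ cokernel.π (coprod.desc (addRel F X) (natRel F X)) = 0 := by
    have := coprod.inl ≫= cokernel.condition (coprod.desc (addRel F X) (natRel F X))
    rwa [coprod.inl_desc_assoc, comp_zero] at this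
  have h' := Sigma.ι (fun r : AddRel X => F.obj r.1) ⟨g, x, y⟩ ≫= h
  rw [Sigma.ι_desc_assoc, comp_zero, Preadditive.sub_comp, Preadditive.sub_comp, sub_sub,
    sub_eq_zero] at h'
  exact h'

lemma ι_map {g g' : G} (h : g' ⟶ g) (x : X.obj.obj (op g)) :
    ι F X g' (X.obj.map h.op x) = F.map h ≫ ι F X g x := by
  have h₁ : natRel F X ≫ cokernel.π (coprod.desc (addRel F X) (natRel F X)) = 0 := by
    have := coprod.inr ≫= cokernel.condition (coprod.desc (addRel F X) (natRel F X))
    rwa [coprod.inr_desc_assoc, comp_zero] at this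
  have h₂ := Sigma.ι (fun r : NatRel X => F.obj r.1.1) ⟨(g', g), h, x⟩ ≫= h₁
  rw [Sigma.ι_desc_assoc, comp_zero, Preadditive.sub_comp, sub_eq_zero, Category.assoc] at h₂
  exact h₂

lemma hom_ext {a : A} {φ ψ : obj F X ⟶ a} (h : ∀ g x, ι F X g x ≫ φ = ι F X g x ≫ ψ) :
    φ = ψ := by
  refine coequalizer.hom_ext (Sigma.hom_ext _ _ fun ⟨g, x⟩ => ?_)
  exact (Category.assoc _ _ _).symm.trans ((h g x).trans (Category.assoc _ _ _))

/-- The morphism `F^* X ⟶ a` given by a compatible family of morphisms `F g ⟶ a`. -/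
def desc {a : A} (f : ∀ g : G, X.obj.obj (op g) → (F.obj g ⟶ a))
    (h₁ : ∀ g x y, f g (x + y) = f g x + f g y)
    (h₂ : ∀ g g' (h : g' ⟶ g) x, f g' (X.obj.map h.op x) = F.map h ≫ f g x) : obj F X ⟶ a :=
  cokernel.desc _ (Sigma.desc fun i => f i.1 i.2) (by
    refine coprod.hom_ext ?_ ?_ <;> refine Sigma.hom_ext _ _ fun r => ?_
    · rw [coprod.inl_desc_assoc, Sigma.ι_desc_assoc, comp_zero, comp_zero, Preadditive.sub_comp,
        Preadditive.sub_comp, Sigma.ι_desc, Sigma.ι_desc, Sigma.ι_desc, h₁]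
      abel
    · rw [coprod.inr_desc_assoc, Sigma.ι_desc_assoc, comp_zero, comp_zero, Preadditive.sub_comp,
        Category.assoc, Sigma.ι_desc, Sigma.ι_desc, h₂, sub_self])

lemma ι_desc {a : A} (f : ∀ g : G, X.obj.obj (op g) → (F.obj g ⟶ a))
    (h₁ : ∀ g x y, f g (x + y) = f g x + f g y)
    (h₂ : ∀ g g' (h : g' ⟶ g) x, f g' (X.obj.map h.op x) = F.map h ≫ f g x) (g : G)
    (x : X.obj.obj (op g)) : ι F X g x ≫ desc f h₁ h₂ = f g x :=
  (Category.assoc _ _ _).trans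
    ((congrArg (incl F X g x ≫ ·) (cokernel.π_desc _ _ _)).trans (Sigma.ι_desc _ _))

variable [F.Additive]

/-- The adjunction bijection `A(F^* X, a) ≃ Mod G (X, F_* a)`. -/
def homEquiv (a : A) : (obj F X ⟶ a) ≃ (X ⟶ (restriction F).obj a) where
  toFun φ := ObjectProperty.homMk
    { app g := AddCommGrpCat.ofHom (Y := AddCommGrpCat.of (F.obj g.unop ⟶ a))
        (AddMonoidHom.mk' (fun x => ι F X g.unop x ≫ φ) fun x y =>
          (congrArg (· ≫ φ) (ι_add (F := F) g.unop x y)).trans (Preadditive.add_comp _ _ _ _ _ _))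
      naturality g g' h := by
        ext x
        exact (congrArg (· ≫ φ) (ι_map (F := F) h.unop x)).trans (Category.assoc _ _ _) }
  invFun α := desc (fun g x => (show F.obj g ⟶ a from (α.hom.app (op g)).hom x))
    (fun g x y => (α.hom.app (op g)).hom.map_add x y)
    (fun g g' h x => ConcreteCategory.congr_hom (α.hom.naturality h.op) x)
  left_inv φ := hom_ext fun g x => ι_desc _ _ _ g x
  right_inv α := by
    ext g x
    exact ι_desc _ _ _ g.unop x

lemma restriction_isRightAdjoint : (restriction F).IsRightAdjoint :=
  ⟨_, ⟨Adjunction.adjunctionOfEquivLeft (G := restriction F)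
    (F_obj := fun X => obj F X) (fun X a => homEquiv (F := F) (X := X) a)
    (fun X a b g h => by
      ext c x
      exact (Category.assoc _ _ _).symm)⟩⟩

end Induction

section Closed

variable {G : Type v} [SmallCategory G] [Preadditive G]

section

variable {A : Type w} [Category.{v} A] [Abelian A] [HasColimits A]

/-- The induction functor `F^* : Mod G ⥤ A` of an additive functor `F : G ⥤ A` into a cocomplete
abelian category: the left adjoint of `F_*`, equivalently the unique colimit preserving functor
whose restriction to the representable modules is `F`. -/
def induction (F : G ⥤ A) [F.Additive] : Mod G ⥤ A :=
  have : (restriction F).IsRightAdjoint := Induction.restriction_isRightAdjoint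
  (restriction F).leftAdjoint

/-- The adjunction between the induction and the restriction functor. -/
def inductionAdjunction (F : G ⥤ A) [F.Additive] : induction F ⊣ restriction F :=
  have : (restriction F).IsRightAdjoint := Induction.restriction_isRightAdjoint
  Adjunction.ofIsRightAdjoint (restriction F)

instance (F : G ⥤ A) [F.Additive] : (induction F).Additive :=
  (inductionAdjunction F).left_adjoint_additive

/-- `Ker F^*`: the modules annihilated by `F^*`. -/
def kerInduction (F : G ⥤ A) [F.Additive] : ObjectProperty (Mod G) :=
  fun X => IsZero ((induction F).obj X)

/-- `F` is generalized `L`-closed: `F^*` annihilates the modules in `L` and preserves exactness of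
sequences `0 → M → N → L' → 0` with `L'` in `L`. -/
structure IsGeneralizedClosed (L : ObjectProperty (Mod G)) (F : G ⥤ A) [F.Additive] : Prop where
  le_ker : L ≤ kerInduction F
  map_shortExact (K : ShortComplex (Mod G)) (hK : K.ShortExact) (hL : L K.X₃) :
    (K.map (induction F)).ShortExact

end

/-- A localizing subcategory of `Mod G`: a full subcategory (containing zero and) closed under
subobjects, quotients, extensions and (small) direct sums. -/
structure IsLocalizing (L : ObjectProperty (Mod G)) : Prop where
  isSerreClass : L.IsSerreClass
  closedUnderCoproducts (K : Type v) : L.IsClosedUnderColimitsOfShape (Discrete K)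

/-- `S : U ⥤ G` is an `L`-conditioned epimorphism: for all additive functors `F, F'` from `G` to a
cocomplete abelian category (with objects in `Type w`), if `F` is generalized `L`-closed then
`F ∘ S = F' ∘ S` implies `F = F'`. -/
def IsConditionedEpi {U : Type v} [SmallCategory U] (L : ObjectProperty (Mod G)) (S : U ⥤ G) :
    Prop :=
  ∀ (A : Type w) [Category.{v} A] [Abelian A] [HasColimits A]
    (F F' : G ⥤ A) [F.Additive] [F'.Additive],
    IsGeneralizedClosed L F → S ⋙ F = S ⋙ F' → F = F'

end Closed

/-! ### The canonical factorization -/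

section Factorization

variable {U : Type v} [SmallCategory U] {C : Type u} [Category.{v} C] (T : U ⥤ C)

/-- The middle category `G` of the canonical factorization of `T : U ⥤ C`: its objects are those
of `U`, and the morphisms from `U'` to `U` are the morphisms `T U' ⟶ T U` in `C`. -/
abbrev Middle : Type v := InducedCategory C T.obj

/-- The functor `S : U ⥤ G` of the canonical factorization: the identity on objects, and `T` on
morphisms. -/
def factorS : U ⥤ Middle T where
  obj X := X
  map f := InducedCategory.homMk (T.map f)

/-- The fully faithful functor `I : G ⥤ C` of the canonical factorization. -/
abbrev factorI : Middle T ⥤ C := inducedFunctor T.obj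

lemma factorS_obj_bijective : Function.Bijective (factorS T).obj := Function.bijective_id

lemma factorS_comp_factorI : factorS T ⋙ factorI T = T := rfl

instance [Preadditive U] [Preadditive C] [T.Additive] : (factorS T).Additive where
  map_add := InducedCategory.hom_ext T.map_add

/-- `G` generates `C`: morphisms of `C` are distinguished by precomposition with morphisms from
the objects `I g`. -/
def MiddleGenerates : Prop :=
  (ObjectProperty.ofObj (factorI T).obj).IsSeparating

end Factorization

end SeveralObjects

end

noncomputable section

namespace SeveralObjects

/-! ### Morphisms of modules in terms of elements -/

section Elements

variable {G : Type v} [SmallCategory G] [Preadditive G]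

/-! If `G` generates `C`, the Gabriel-Popescu theorem makes `I_*` fully faithful and `I^*` exact, so
`C` is the localization of `Mod G` at `Ker I^*`; this gives the supplementary claims and rests on
Mitchell's lemma `kernel_ι_comp_sigmaElt`. Faithfulness of `T_*` amounts to generation. Fullness of
`T_*` then means that a family of additive maps `C(T u, c) → C(T u, c')` natural over `U` is
automatically natural over `G`.

Suppose `T_*` is fully faithful, `F` is generalized closed and `F ∘ S = F' ∘ S`. By
`restriction_obj_mem_essImage`, `F_* (F g) ≅ I_* c` for some `c`. Read in `I_* c`, the action of
`F'` on morphisms into `g` is natural over `U`, hence is precomposition to one morphism `k` of `C`.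
Evaluation at the identity of `g` shows that `F` gives the same `k`.

Conversely, the functor `C(I -, X)` into the opposite of abelian groups is generalized closed
(`isGeneralizedClosed_homOp`). A family `α` natural over `U` defines, for `X = c ⊞ c'`, an
automorphism `h ↦ h + α (h ≫ fst) ≫ inr` natural over `U`. Conjugation by it does not change the
composite with `S`, so condition 2 forces the conjugate to equal the original functor. This equality
is naturality over `G`. -/

lemma mod_hom_ext {M N : Mod G} {α β : M ⟶ N}
    (h : ∀ (g : G) (x : M.obj.obj (op g)), α.hom.app (op g) x = β.hom.app (op g) x) : α = β := by
  ext g x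
  exact h g.unop x

/-- The morphism from a representable module to `M` given by an element of `M`. -/
def yonedaMap {M : Mod G} {g : G} (x : M.obj.obj (op g)) : (restriction (𝟭 G)).obj g ⟶ M :=
  ObjectProperty.homMk
    { app h := AddCommGrpCat.ofHom (X := AddCommGrpCat.of (h.unop ⟶ g))
        (AddMonoidHom.mk' (fun f => M.obj.map f.op x) fun f f' => by
          rw [op_add, M.obj.map_add]; rfl)
      naturality h h' k := by
        ext f
        exact ConcreteCategory.congr_hom (M.obj.map_comp f.op k) x }

lemma yonedaMap_id {M : Mod G} {g : G} (x : M.obj.obj (op g)) :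
    (yonedaMap x).hom.app (op g) (𝟙 g : g ⟶ g) = x :=
  ConcreteCategory.congr_hom (M.obj.map_id (op g)) x

lemma yonedaMap_comp {M N : Mod G} (α : M ⟶ N) {g : G} (x : M.obj.obj (op g)) :
    yonedaMap x ≫ α = yonedaMap (α.hom.app (op g) x) :=
  mod_hom_ext fun _ f => ConcreteCategory.congr_hom (α.hom.naturality (Quiver.Hom.op f)) x

/-- Elements are morphisms from representables, so a monomorphism separates them. -/
lemma injective_of_mono {M N : Mod G} (α : M ⟶ N) [Mono α] (g : G) :
    Function.Injective (α.hom.app (op g)) := by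
  intro x y h
  have : yonedaMap x = yonedaMap y := by
    rw [← cancel_mono α, yonedaMap_comp, yonedaMap_comp, h]
  rw [← yonedaMap_id x, this, yonedaMap_id]

lemma mono_of_injective {M N : Mod G} (α : M ⟶ N)
    (h : ∀ g, Function.Injective (α.hom.app (op g))) : Mono α where
  right_cancellation _ _ e := mod_hom_ext fun g x => h g <|
    ConcreteCategory.congr_hom (NatTrans.congr_app (congrArg (·.hom) e) (op g)) x

lemma epi_of_surjective {M N : Mod G} (α : M ⟶ N)
    (h : ∀ g, Function.Surjective (α.hom.app (op g))) : Epi α where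
  left_cancellation _ _ e := mod_hom_ext fun g y => by
    obtain ⟨x, rfl⟩ := h g y
    exact ConcreteCategory.congr_hom (NatTrans.congr_app (congrArg (·.hom) e) (op g)) x

variable {A : Type w} [Category.{v} A] [Preadditive A] {F : G ⥤ A} [F.Additive] {M N : Mod G}

/-- The value at an element of `M` of a morphism `M ⟶ F_* a`. -/
def elt {a : A} (α : M ⟶ (restriction F).obj a) (g : G) (x : M.obj.obj (op g)) : F.obj g ⟶ a :=
  α.hom.app (op g) x

lemma elt_ext {a : A} {α β : M ⟶ (restriction F).obj a} (h : ∀ g x, elt α g x = elt β g x) :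
    α = β :=
  mod_hom_ext h

/-- Morphisms `M ⟶ F_* a` from their values at elements. -/
def homOfElt {a : A} (f : ∀ g : G, M.obj.obj (op g) → (F.obj g ⟶ a))
    (h₁ : ∀ g x y, f g (x + y) = f g x + f g y)
    (h₂ : ∀ g g' (h : g' ⟶ g) x, f g' (M.obj.map h.op x) = F.map h ≫ f g x) :
    M ⟶ (restriction F).obj a :=
  ObjectProperty.homMk
    { app g := AddCommGrpCat.ofHom (Y := AddCommGrpCat.of (F.obj g.unop ⟶ a))
        (AddMonoidHom.mk' (f g.unop) (h₁ g.unop))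
      naturality g g' h := by
        ext x
        exact h₂ _ _ h.unop x }

lemma elt_add {a : A} (α : M ⟶ (restriction F).obj a) {g : G} (x y : M.obj.obj (op g)) :
    elt α g (x + y) = elt α g x + elt α g y :=
  (α.hom.app (op g)).hom.map_add x y

lemma elt_zero {a : A} (α : M ⟶ (restriction F).obj a) {g : G} :
    elt α g 0 = 0 :=
  (α.hom.app (op g)).hom.map_zero

lemma elt_sum {a : A} (α : M ⟶ (restriction F).obj a) {g : G} {ι : Type*} (s : Finset ι)
    (x : ι → M.obj.obj (op g)) : elt α g (∑ i ∈ s, x i) = ∑ i ∈ s, elt α g (x i) :=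
  map_sum (α.hom.app (op g)).hom x s

lemma elt_map {a : A} (α : M ⟶ (restriction F).obj a) {g g' : G} (h : g' ⟶ g)
    (x : M.obj.obj (op g)) : elt α g' (M.obj.map h.op x) = F.map h ≫ elt α g x :=
  ConcreteCategory.congr_hom (α.hom.naturality h.op) x

lemma elt_comp {a : A} (β : N ⟶ M) (α : M ⟶ (restriction F).obj a) (g : G)
    (x : N.obj.obj (op g)) : elt (β ≫ α) g x = elt α g (β.hom.app (op g) x) := rfl

lemma elt_comp_map {a b : A} (α : M ⟶ (restriction F).obj a) (φ : a ⟶ b) (g : G)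
    (x : M.obj.obj (op g)) : elt (α ≫ (restriction F).map φ) g x = elt α g x ≫ φ := rfl

lemma elt_injective {a : A} (α : M ⟶ (restriction F).obj a) [Mono α] (g : G) :
    Function.Injective (elt α g) :=
  injective_of_mono α g

end Elements

/-! ### The Gabriel-Popescu theorem for a generating family -/

/-- For a right exact functor `Φ` and an epimorphism `p`, if `Φ` preserves the monomorphism obtained
from `a` by pulling back along `p`, then it preserves `a`. -/
lemma mono_map_of_epi {D : Type*} {C : Type*} [Category* D] [Category* C] [Abelian D] [Abelian C]
    (Φ : D ⥤ C) [Φ.Additive] [PreservesFiniteColimits Φ] {M N P : D} (a : M ⟶ N) (p : P ⟶ N)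
    [Epi p] [Mono (Φ.map (pullback.snd a p))] : Mono (Φ.map a) := by
  have hK : (ShortComplex.mk (Φ.map (kernel.ι p)) (Φ.map p)
      (by rw [← Φ.map_comp, kernel.condition, Φ.map_zero])).Exact :=
    (ShortComplex.exact_kernel p).map_of_epi_of_preservesCokernel Φ ‹_› inferInstance
  refine Preadditive.mono_of_cancel_zero _ fun {Z} z hz => ?_
  obtain ⟨Z', π, _, z', hz'⟩ := surjective_up_to_refinements_of_epi (Φ.map (pullback.fst a p)) z
  obtain ⟨Z'', π', _, y, hy⟩ := hK.exact_up_to_refinements (z' ≫ Φ.map (pullback.snd a p)) (by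
    change (z' ≫ Φ.map (pullback.snd a p)) ≫ Φ.map p = 0
    rw [Category.assoc, ← Φ.map_comp, ← pullback.condition, Φ.map_comp, ← reassoc_of% hz', hz,
      comp_zero])
  change π' ≫ z' ≫ Φ.map (pullback.snd a p) = y ≫ Φ.map (kernel.ι p) at hy
  -- `kernel p` sits in the pullback as `(0, kernel.ι p)`. As `Φ.map (pullback.snd a p)` is mono,
  -- `z'` comes locally from there, where the first projection vanishes.
  have h : π' ≫ z' = y ≫ Φ.map (pullback.lift 0 (kernel.ι p) (by simp)) := by
    rw [← cancel_mono (Φ.map (pullback.snd a p)), Category.assoc, hy]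
    refine Eq.trans ?_ (Category.assoc _ _ _).symm
    rw [← Φ.map_comp (pullback.lift _ _ _), pullback.lift_snd]
  rw [← cancel_epi π, ← cancel_epi π', hz', reassoc_of% h]
  rw [← Φ.map_comp (pullback.lift _ _ _), pullback.lift_fst, Φ.map_zero, comp_zero,
    comp_zero, comp_zero]

section GabrielPopescu

variable {G : Type v} [SmallCategory G] [Preadditive G]
variable {C : Type u} [Category.{v} C] [Abelian C] [HasColimits C]
variable {F : G ⥤ C} [F.Additive] {M N : Mod G}

/-- The morphism from the direct sum of the `F g`, over all elements of `M`, induced by a morphism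
`M ⟶ F_* a`. -/
def sigmaElt {a : C} (α : M ⟶ (restriction F).obj a) : Induction.free F M ⟶ a :=
  Sigma.desc fun i => elt α i.1 i.2

lemma ι_sigmaElt {a : C} (α : M ⟶ (restriction F).obj a) (i : Induction.Gen M) :
    Sigma.ι (fun i : Induction.Gen M => F.obj i.1) i ≫ sigmaElt α = elt α i.1 i.2 :=
  Sigma.ι_desc _ _

lemma sigmaElt_comp {a b : C} (α : M ⟶ (restriction F).obj a) (φ : a ⟶ b) :
    sigmaElt (α ≫ (restriction F).map φ) = sigmaElt α ≫ φ :=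
  Sigma.hom_ext _ _ fun i => by
    rw [ι_sigmaElt, ← Category.assoc, ι_sigmaElt, elt_comp_map]

/-- By adjunction, a morphism out of `F^* M` is determined by its composites with the values of the
unit. -/
lemma epi_sigmaElt_unit (F : G ⥤ C) [F.Additive] (M : Mod G) :
    Epi (sigmaElt ((inductionAdjunction F).unit.app M)) where
  left_cancellation φ ψ h := by
    refine ((inductionAdjunction F).homEquiv _ _).injective (elt_ext fun g x => ?_)
    rw [Adjunction.homEquiv_unit, Adjunction.homEquiv_unit]
    have := Sigma.ι (fun i : Induction.Gen M => F.obj i.1) ⟨g, x⟩ ≫= h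
    rwa [← sigmaElt_comp, ← sigmaElt_comp, ι_sigmaElt, ι_sigmaElt] at this

open CoproductsFromFiniteFiltered in
attribute [local instance] IsFiltered.isConnected in
-- By AB5, `K` is the filtered colimit of its pullbacks to the finite subcoproducts, and on each of
-- these `k` is a finite sum of components.
lemma comp_eq_zero_of_finite_sums [AB5 C] {J : Type v} (X : J → C) {K b : C} (k : K ⟶ ∐ X)
    (f : ∐ X ⟶ b)
    (hf : ∀ (K' : C) (l : K' ⟶ K) (s : Finset J) (h : ∀ j, K' ⟶ X j),
      l ≫ k = ∑ j ∈ s, h j ≫ Sigma.ι X j → l ≫ k ≫ f = 0) : k ≫ f = 0 := by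
  classical
  refine (isColimitFiniteSubproductsCocone X).pullback_zero_ext (fun s => ?_)
  -- The value `0` outside `s` is harmless: the sum only runs over `s`.
  refine hf _ _ (s.map discreteEquiv.toEmbedding) (fun j =>
    if hj : Discrete.mk j ∈ s then
      pullback.fst ((finiteSubcoproductsCocone X).ι.app s) k ≫
        Sigma.π (fun i : s => X i.1.as) ⟨_, hj⟩ else 0) ?_
  refine pullback.condition.symm.trans ?_
  refine (congrArg (pullback.fst _ _ ≫ ·) (finiteSubcoproductsCocone_ι_app_eq_sum X s)).trans ?_
  rw [Finset.sum_map, ← Finset.sum_attach s]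
  refine (Preadditive.comp_sum _ _ _).trans (Finset.sum_congr rfl fun j _ => ?_)
  refine (Category.assoc _ _ _).symm.trans ?_
  refine congrArg (· ≫ Sigma.ι X _) ?_
  have hj : Discrete.mk (discreteEquiv.toEmbedding j.1) ∈ s := j.2
  simp only [hj, ↓reduceDIte]
  rfl

/-- Mitchell's lemma. -/
theorem kernel_ι_comp_sigmaElt [AB5 C] [F.Full]
    (hF : (ObjectProperty.ofObj F.obj).IsSeparating) {a b : C} (α : M ⟶ (restriction F).obj a)
    [Mono α] (β : M ⟶ (restriction F).obj b) : kernel.ι (sigmaElt α) ≫ sigmaElt β = 0 := by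
  refine comp_eq_zero_of_finite_sums _ _ _ fun K l s h e => hF _ _ ?_
  rintro _ ⟨g⟩ t
  -- By fullness the components `t ≫ h i` come from `G`, so the composite is the value of `γ` at one
  -- element of `M` that does not depend on `γ`. For `γ = α` this value is zero, so the element is
  -- zero.
  have key {c : C} (γ : M ⟶ (restriction F).obj c) :
      t ≫ l ≫ kernel.ι (sigmaElt α) ≫ sigmaElt γ =
        elt γ g (∑ i ∈ s, M.obj.map (F.preimage (t ≫ h i)).op i.2) := by
    rw [reassoc_of% e, elt_sum, Preadditive.sum_comp, Preadditive.comp_sum]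
    refine Finset.sum_congr rfl fun i _ => ?_
    rw [elt_map, Functor.map_preimage, Category.assoc, ι_sigmaElt, Category.assoc]
  rw [key, comp_zero, elt_injective α g (a₁ := ∑ i ∈ s, M.obj.map (F.preimage (t ≫ h i)).op i.2)
    (a₂ := 0), elt_zero]
  rw [← key, kernel.condition, comp_zero, comp_zero, elt_zero]

/-- A morphism `F^* M ⟶ a` is a monomorphism if the adjunct morphism `M ⟶ F_* a` is. -/
lemma mono_homEquiv_symm [AB5 C] [F.Full] (hF : (ObjectProperty.ofObj F.obj).IsSeparating) {a : C}
    (α : M ⟶ (restriction F).obj a) [Mono α] :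
    Mono (((inductionAdjunction F).homEquiv _ _).symm α) := by
  have := epi_sigmaElt_unit F M
  refine Preadditive.mono_of_cancel_zero _ fun {Z} z hz => ?_
  obtain ⟨Z', p, hp, y, hy⟩ := surjective_up_to_refinements_of_epi
    (sigmaElt ((inductionAdjunction F).unit.app M)) z
  have e : sigmaElt ((inductionAdjunction F).unit.app M) ≫
      ((inductionAdjunction F).homEquiv _ _).symm α = sigmaElt α := by
    refine (sigmaElt_comp _ _).symm.trans (congrArg sigmaElt ?_)
    exact (Adjunction.homEquiv_unit _ _ _ _).symm.trans (Equiv.apply_symm_apply _ _)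
  have hy' : y ≫ sigmaElt α = 0 := by
    rw [← e, ← reassoc_of% hy, hz, comp_zero]
  -- Mitchell's lemma with the unit as second morphism: the kernel of `sigmaElt α` already dies in
  -- `F^* M`.
  rw [← cancel_epi p, hy, comp_zero, ← kernel.lift_ι _ y hy', Category.assoc,
    kernel_ι_comp_sigmaElt hF α, comp_zero]

omit [HasColimits C] in
lemma restriction_faithful (hF : (ObjectProperty.ofObj F.obj).IsSeparating) :
    (restriction F).Faithful where
  map_injective {a b φ ψ} h := hF _ _ <| by
    rintro _ ⟨g⟩ t
    exact ConcreteCategory.congr_hom (NatTrans.congr_app (congrArg (·.hom) h) (op g)) t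

/-- The counit is adjunct to an identity, hence mono, and it is epi because `F_*` is faithful. -/
theorem restriction_full [AB5 C] [F.Full] (hF : (ObjectProperty.ofObj F.obj).IsSeparating) :
    (restriction F).Full := by
  have := restriction_faithful hF
  have (a : C) : IsIso ((inductionAdjunction F).counit.app a) := by
    have : Mono ((inductionAdjunction F).counit.app a) := by
      rw [← Adjunction.homEquiv_symm_id]
      exact mono_homEquiv_symm hF _
    exact isIso_of_mono_of_epi _
  have := NatIso.isIso_of_isIso_app (inductionAdjunction F).counit
  exact ((inductionAdjunction F).fullyFaithfulROfIsIsoCounit).full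

/-- The direct sum of the representable modules given by the elements of `N`. -/
def freeCover (N : Mod G) : Mod G where
  obj :=
    { obj h := AddCommGrpCat.of (Π₀ i : Induction.Gen N, h.unop ⟶ i.1)
      map k := AddCommGrpCat.ofHom
        (DFinsupp.mapRange.addMonoidHom fun i => Preadditive.leftComp i.1 k.unop)
      map_id _ := AddCommGrpCat.hom_ext <| AddMonoidHom.ext fun x => DFinsupp.ext fun i =>
        Category.id_comp (x i)
      map_comp k k' := AddCommGrpCat.hom_ext <| AddMonoidHom.ext fun x => DFinsupp.ext fun i =>
        Category.assoc k'.unop k.unop (x i) }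
  property := ⟨fun {_ _ k k'} => AddCommGrpCat.hom_ext <| AddMonoidHom.ext fun x =>
    DFinsupp.ext fun i => Preadditive.add_comp _ _ _ k.unop k'.unop (x i)⟩

open Classical in
/-- The morphism from `freeCover N` given by a family of morphisms from representable modules. -/
def freeCoverDesc {N M : Mod G} (f : ∀ i : Induction.Gen N, (restriction (𝟭 G)).obj i.1 ⟶ M) :
    freeCover N ⟶ M :=
  ObjectProperty.homMk
    { app h := AddCommGrpCat.ofHom (X := AddCommGrpCat.of (Π₀ i : Induction.Gen N, h.unop ⟶ i.1))
        (DFinsupp.sumAddHom fun i => ((f i).hom.app h).hom)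
      naturality h h' k := AddCommGrpCat.hom_ext <| DFinsupp.addHom_ext fun i y => by
        refine (congrArg (DFinsupp.sumAddHom fun i => ((f i).hom.app h').hom)
          (DFinsupp.mapRange_single
            (f := fun (i : Induction.Gen N) (x : h.unop ⟶ i.1) => k.unop ≫ x)
            (hf := fun _ => comp_zero))).trans ?_
        refine (DFinsupp.sumAddHom_single (fun i : Induction.Gen N => ((f i).hom.app h').hom) i
          (show h'.unop ⟶ i.1 from k.unop ≫ y)).trans ?_
        refine Eq.trans ?_
          (congrArg (M.obj.map k) (DFinsupp.sumAddHom_single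
            (fun i => ((f i).hom.app h).hom) i y)).symm
        exact ConcreteCategory.congr_hom ((f i).hom.naturality k) y }

open Classical in
lemma freeCoverDesc_single {N M : Mod G}
    (f : ∀ i : Induction.Gen N, (restriction (𝟭 G)).obj i.1 ⟶ M) (i : Induction.Gen N) {h : G}
    (y : h ⟶ i.1) : (freeCoverDesc f).hom.app (op h) (DFinsupp.single i y) =
      (f i).hom.app (op h) y :=
  DFinsupp.sumAddHom_single _ _ _

lemma epi_freeCoverDesc (N : Mod G) : Epi (freeCoverDesc fun i : Induction.Gen N => yonedaMap i.2) :=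
  epi_of_surjective _ fun g x => by
    classical
    exact ⟨_, (freeCoverDesc_single _ ⟨g, x⟩ (𝟙 g)).trans (yonedaMap_id x)⟩

/-- The coordinates of the image of `x` are the `F.map (x i)`, which determine `x` when `F` is
faithful. -/
lemma exists_mono_freeCover [F.Faithful] (N : Mod G) :
    ∃ α : freeCover N ⟶ (restriction F).obj (Induction.free F N), Mono α := by
  classical
  let f (i : Induction.Gen N) :
      (restriction (𝟭 G)).obj i.1 ⟶ (restriction F).obj (Induction.free F N) :=
    homOfElt (fun g y => F.map y ≫ Sigma.ι (fun i : Induction.Gen N => F.obj i.1) i)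
      (fun g x y => (congrArg (· ≫ _) F.map_add).trans (Preadditive.add_comp _ _ _ _ _ _))
      (fun g g' h x => (congrArg (· ≫ _) (F.map_comp h x)).trans (Category.assoc _ _ _))
  refine ⟨freeCoverDesc f, mono_of_injective _ fun g => ?_⟩
  have key (i : Induction.Gen N) (x : Π₀ i : Induction.Gen N, g ⟶ i.1) :
      elt (freeCoverDesc f) g x ≫ Sigma.π (fun i : Induction.Gen N => F.obj i.1) i =
        F.map (x i) := by
    suffices h : (Preadditive.rightComp _ (Sigma.π (fun i : Induction.Gen N => F.obj i.1) i)).comp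
        ((freeCoverDesc f).hom.app (op g)).hom = F.mapAddHom.comp
          (DFinsupp.evalAddMonoidHom (β := fun i : Induction.Gen N => g ⟶ i.1) i) from
      DFunLike.congr_fun h x
    refine DFinsupp.addHom_ext fun j y => ?_
    refine (congrArg (· ≫ Sigma.π _ i) (freeCoverDesc_single f j y)).trans ?_
    refine (Category.assoc _ _ _).trans ?_
    obtain rfl | hij := eq_or_ne j i
    · refine (congrArg (F.map y ≫ ·) (Sigma.ι_π_eq_id _ j)).trans ((Category.comp_id _).trans ?_)
      exact congrArg F.map (DFinsupp.single_eq_same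
        (β := fun i : Induction.Gen N => g ⟶ i.1) (i := j) (b := y)).symm
    · refine (congrArg (F.map y ≫ ·) (Sigma.ι_π_of_ne
        (fun i : Induction.Gen N => F.obj i.1) hij)).trans (comp_zero.trans ?_)
      exact (F.map_zero _ _).symm.trans (congrArg F.map (DFinsupp.single_eq_of_ne
        (β := fun i : Induction.Gen N => g ⟶ i.1) hij.symm).symm)
  intro x y hxy
  refine DFinsupp.ext fun i => F.map_injective ?_
  rw [← key i x, ← key i y]
  exact congrArg (· ≫ Sigma.π _ i) hxy

instance (F : G ⥤ C) [F.Additive] : (induction F).IsLeftAdjoint :=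
  (inductionAdjunction F).isLeftAdjoint

instance (F : G ⥤ C) [F.Additive] : PreservesFiniteColimits (induction F) where
  preservesFiniteColimits _ _ _ := inferInstance

/-- Pulling back along a free cover reduces to subobjects of `freeCover N`. These embed in some `F_*
a`, where `mono_homEquiv_symm` applies. -/
theorem induction_preservesMonomorphisms [AB5 C] [F.Full] [F.Faithful]
    (hF : (ObjectProperty.ofObj F.obj).IsSeparating) :
    (induction F).PreservesMonomorphisms where
  preserves {M N} a _ := by
    let p : freeCover N ⟶ N := freeCoverDesc fun i : Induction.Gen N => yonedaMap i.2
    have : Epi p := epi_freeCoverDesc N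
    obtain ⟨e, he⟩ := exists_mono_freeCover (F := F) N
    have : Mono ((induction F).map (pullback.snd a p)) := by
      have : Mono ((induction F).map (pullback.snd a p) ≫
          ((inductionAdjunction F).homEquiv _ _).symm e) := by
        rw [← Adjunction.homEquiv_naturality_left_symm]
        exact mono_homEquiv_symm hF _
      exact mono_of_mono _ (((inductionAdjunction F).homEquiv _ _).symm e)
    exact mono_map_of_epi (induction F) a p

theorem induction_preservesFiniteLimits [AB5 C] [F.Full] [F.Faithful]
    (hF : (ObjectProperty.ofObj F.obj).IsSeparating) : PreservesFiniteLimits (induction F) := by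
  have := induction_preservesMonomorphisms hF
  have : (induction F).PreservesHomology :=
    (induction F).preservesHomology_of_preservesMonos_and_cokernels
  exact (induction F).preservesFiniteLimits_of_preservesHomology

end GabrielPopescu

/-! ### The localizing subcategory `Ker I^*` and its generalized closed functors -/

section Localization

variable {G : Type v} [SmallCategory G] [Preadditive G]
variable {C : Type u} [Category.{v} C] [Abelian C] [HasColimits C] [AB5 C]
variable {I : G ⥤ C} [I.Additive] [I.Full] [I.Faithful]

theorem isLocalizing_kerInduction (hI : (ObjectProperty.ofObj I.obj).IsSeparating) :
    IsLocalizing (kerInduction I) where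
  isSerreClass :=
    have := induction_preservesFiniteLimits hI
    inferInstanceAs
      ((ObjectProperty.inverseImage (IsZero (C := C)) (induction I)).IsSerreClass)
  closedUnderCoproducts K := ⟨by
    rintro X ⟨p⟩
    refine (IsZero.iff_id_eq_zero _).2
      ((isColimitOfPreserves (induction I) p.isColimit).hom_ext fun k => ?_)
    exact (p.prop_diag_obj k).eq_of_src _ _⟩

omit [I.Additive] [I.Full] [I.Faithful] [Preadditive G] in
theorem isGrothendieckAbelian_of_isSeparating
    (hI : (ObjectProperty.ofObj I.obj).IsSeparating) : IsGrothendieckAbelian.{v} C where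
  hasSeparator := ⟨_, (isSeparator_sigma I.obj).2 hI⟩

variable {A : Type w} [Category.{v} A] [Abelian A] [HasColimits A] {F : G ⥤ A} [F.Additive]

/-- The induction functor of a generalized closed functor inverts the morphisms inverted
by `I^*`. -/
lemma isIso_map_of_isGeneralizedClosed (hI : (ObjectProperty.ofObj I.obj).IsSeparating)
    (hF : IsGeneralizedClosed (kerInduction I) F) {M N : Mod G} (a : M ⟶ N)
    [IsIso ((induction I).map a)] : IsIso ((induction F).map a) := by
  have := induction_preservesFiniteLimits hI
  have hp : Mono ((induction I).map (factorThruImage a)) := by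
    have : Mono ((induction I).map (factorThruImage a) ≫ (induction I).map (image.ι a)) := by
      rw [← Functor.map_comp, image.fac]
      infer_instance
    exact mono_of_mono _ ((induction I).map (image.ι a))
  have hι : Epi ((induction I).map (image.ι a)) := by
    have : Epi ((induction I).map (factorThruImage a) ≫ (induction I).map (image.ι a)) := by
      rw [← Functor.map_comp, image.fac]
      infer_instance
    exact epi_of_epi ((induction I).map (factorThruImage a)) _
  have hK : kerInduction I (kernel (factorThruImage a)) := by
    refine IsZero.of_mono_eq_zero ((induction I).map (kernel.ι (factorThruImage a))) ?_
    rw [← cancel_mono ((induction I).map (factorThruImage a)), ← Functor.map_comp,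
      kernel.condition, Functor.map_zero, zero_comp]
  have hL : kerInduction I (cokernel (image.ι a)) := by
    refine IsZero.of_epi_eq_zero ((induction I).map (cokernel.π (image.ι a))) ?_
    rw [← cancel_epi ((induction I).map (image.ι a)), ← Functor.map_comp,
      cokernel.condition, Functor.map_zero, comp_zero]
  -- For the epimorphic part, right exactness of `F^*` and vanishing on the kernel suffice.
  have h₁ : IsIso ((induction F).map (factorThruImage a)) := by
    have : Mono ((induction F).map (factorThruImage a)) :=
      ((ShortComplex.exact_kernel (factorThruImage a)).map_of_epi_of_preservesCokernel
        (induction F) inferInstance inferInstance).mono_g ((hF.le_ker _ hK).eq_of_src _ _)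
    exact isIso_of_mono_of_epi _
  -- For the monomorphic part, exactness on sequences with third term in `Ker I^*` is needed.
  have h₂ : IsIso ((induction F).map (image.ι a)) := by
    have h := hF.map_shortExact
      (ShortComplex.mk (image.ι a) (cokernel.π (image.ι a)) (cokernel.condition _))
      { exact := ShortComplex.exact_cokernel _ } hL
    have : Mono ((induction F).map (image.ι a)) := h.mono_f
    have : Epi ((induction F).map (image.ι a)) :=
      h.exact.epi_f ((hF.le_ker _ hL).eq_of_tgt _ _)
    exact isIso_of_mono_of_epi _
  rw [← image.fac a, Functor.map_comp]
  infer_instance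

/-- The restriction functor of a generalized closed functor factors through `I_*`. -/
lemma restriction_obj_mem_essImage (hI : (ObjectProperty.ofObj I.obj).IsSeparating)
    (hF : IsGeneralizedClosed (kerInduction I) F) (a : A) :
    (restriction I).essImage ((restriction F).obj a) := by
  have := restriction_full hI
  have := restriction_faithful hI
  let : Reflective (restriction I) := { L := induction I, adj := inductionAdjunction I }
  let η : (restriction F).obj a ⟶ (restriction I).obj ((induction I).obj ((restriction F).obj a)) :=
    (inductionAdjunction I).unit.app ((restriction F).obj a)
  have : IsIso ((induction I).map η) :=
    inferInstanceAs (IsIso ((induction I).map ((inductionAdjunction I).unit.app _)))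
  have : IsIso ((induction F).map η) := isIso_map_of_isGeneralizedClosed hI hF η
  let ε : (induction F).obj ((restriction F).obj a) ⟶ a := (inductionAdjunction F).counit.app a
  -- As `F^* η` is invertible, morphisms into `F_* a` extend along `η`; extending the identity gives
  -- a retraction of the unit.
  let r := inv ((induction F).map η) ≫ ε
  have h : η ≫ (inductionAdjunction F).homEquiv _ _ r = 𝟙 _ := by
    rw [← Adjunction.homEquiv_naturality_left, IsIso.hom_inv_id_assoc]
    exact (Adjunction.homEquiv_unit _ _ _ _).trans
      ((inductionAdjunction F).right_triangle_components a)
  have : IsSplitMono ((reflectorAdjunction (restriction I)).unit.app ((restriction F).obj a)) :=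
    ⟨⟨_, h⟩⟩
  exact mem_essImage_of_unit_isSplitMono

end Localization

/-! ### Generalized lax epimorphisms are conditioned epimorphisms -/

section LaxEpi

variable {U : Type v} [SmallCategory U] [Preadditive U] {C : Type u} [Category.{v} C] [Abelian C]
variable (T : U ⥤ C) [T.Additive]

lemma middleGenerates_of_faithful (hT : (restriction T).Faithful) : MiddleGenerates T :=
  fun _ _ _ _ h => hT.map_injective <| mod_hom_ext fun _ x => h _ ⟨_⟩ x

theorem isConditionedEpi_of_isGeneralizedLaxEpi [HasColimits C] [AB5 C]
    (hT : IsGeneralizedLaxEpi T) :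
    IsConditionedEpi.{v, w} (kerInduction (factorI T)) (factorS T) := by
  intro A _ _ _ F F' _ _ hF h
  have hI : MiddleGenerates T := middleGenerates_of_faithful T hT.2
  have e (u : Middle T) : F.obj u = F'.obj u := Functor.congr_obj h u
  have e' {u u' : U} (f : u ⟶ u') : F.map ((factorS T).map f) =
      eqToHom (e u) ≫ F'.map ((factorS T).map f) ≫ eqToHom (e u').symm := Functor.congr_hom h f
  refine CategoryTheory.Functor.ext e fun u g x => ?_
  obtain ⟨c, ⟨σ⟩⟩ := restriction_obj_mem_essImage hI hF (F.obj g)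
  let τ : (restriction F).obj (F.obj g) ⟶ (restriction (factorI T)).obj c := σ.inv
  -- The action of `F'` on morphisms into `g`, transported to the objects `F u`.
  let F'' (u : Middle T) (x : u ⟶ g) : F.obj u ⟶ F.obj g :=
    eqToHom (e u) ≫ F'.map x ≫ eqToHom (e g).symm
  have hadd (u : Middle T) (x y : u ⟶ g) : F'' u (x + y) = F'' u x + F'' u y := by
    simp only [F'', F'.map_add, Preadditive.add_comp, Preadditive.comp_add]
  have hmap (u u' : Middle T) (f : u' ⟶ u) (x : u ⟶ g) :
      F'' u' (f ≫ x) = (eqToHom (e u') ≫ F'.map f ≫ eqToHom (e u).symm) ≫ F'' u x := by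
    simp [F'']
  have hid : F'' g (𝟙 g) = 𝟙 _ := by
    simp [F'']
  -- `F` and `F'` are only known to agree along `S`, so this family is natural over `U` only;
  -- fullness of `T_*` is what represents it by a morphism of `C`.
  let α : (restriction T).obj (T.obj g) ⟶ (restriction T).obj c :=
    homOfElt (fun u x => elt τ u (F'' u (InducedCategory.homMk x)))
      (fun u x y => (congrArg (elt τ u) (hadd u _ _)).trans (elt_add _ _ _))
      (fun u u' f x => (congrArg (elt τ u') ((hmap u u' ((factorS T).map f) _).trans
        (congrArg (· ≫ F'' u (InducedCategory.homMk x)) (e' f).symm))).trans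
        (elt_map τ ((factorS T).map f) (F'' u (InducedCategory.homMk x))))
  obtain ⟨k, hk⟩ := hT.1.map_surjective α
  have hk' (u : Middle T) (x : u ⟶ g) : x.hom ≫ k = elt τ u (F'' u x) :=
    congrArg (fun β : (restriction T).obj (T.obj g) ⟶ _ => elt β u x.hom) hk
  have hk'' : k = elt τ g (𝟙 (F.obj g)) := by
    rw [← hid, ← hk']
    exact (Category.id_comp k).symm
  apply elt_injective τ u
  refine Eq.trans ?_ (hk' u x)
  rw [hk'']
  exact (congrArg (elt τ u) (Category.comp_id _).symm).trans (elt_map τ x (𝟙 (F.obj g)))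

end LaxEpi

/-! ### Generalized closedness from locality -/

lemma bijective_precomp_iff {D : Type*} {C : Type*} [Category* D] [Category* C] {L : D ⥤ C}
    {R : C ⥤ D} (adj : L ⊣ R) {M N : D} (f : M ⟶ N) (X : C) :
    Function.Bijective (fun φ : L.obj N ⟶ X => L.map f ≫ φ) ↔
      Function.Bijective (fun β : N ⟶ R.obj X => f ≫ β) := by
  rw [← (adj.homEquiv M X).comp_bijective, ← (adj.homEquiv N X).bijective_comp]
  refine iff_of_eq (congrArg _ (funext fun φ => ?_))
  exact adj.homEquiv_naturality_left f φ

section Local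

variable {G : Type v} [SmallCategory G] [Preadditive G]
variable {C : Type u} [Category.{v} C] [Abelian C] [HasColimits C] [AB5 C]
variable {I : G ⥤ C} [I.Additive] [I.Full] [I.Faithful]
variable {A : Type w} [Category.{v} A] [Abelian A] [HasColimits A] {F : G ⥤ A} [F.Additive]

/-- An additive functor is generalized closed if the modules `F_* a` are local with respect to the
morphisms inverted by `I^*`. -/
lemma isGeneralizedClosed_of_local (hI : (ObjectProperty.ofObj I.obj).IsSeparating)
    (hF : ∀ (a : A) {M N : Mod G} (f : M ⟶ N), IsIso ((induction I).map f) →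
      Function.Bijective (fun β : N ⟶ (restriction F).obj a => f ≫ β)) :
    IsGeneralizedClosed (kerInduction I) F := by
  have := induction_preservesFiniteLimits hI
  have hker : kerInduction I ≤ kerInduction F := fun L hL => by
    -- `I^*` inverts `0 ⟶ L`, so a local module receives only the zero morphism from `L`.
    have h0 : IsZero ((induction I).obj 0) := (induction I).map_isZero (isZero_zero _)
    refine (IsZero.iff_id_eq_zero _).2 (((inductionAdjunction F).homEquiv _ _).injective ?_)
    exact (hF _ (0 : 0 ⟶ L) ⟨0, h0.eq_of_src _ _, hL.eq_of_src _ _⟩).1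
      ((isZero_zero (Mod G)).eq_of_src _ _)
  refine ⟨hker, fun K hK hL => ?_⟩
  have h := hK.map_of_exact (induction I)
  have hmono : Mono ((induction I).map K.f) := h.mono_f
  have hepi : Epi ((induction I).map K.f) := h.exact.epi_f (hL.eq_of_tgt _ _)
  -- Here `I^*` inverts `K.f`, so locality of all `F_* a` and Yoneda make `F^*` invert it too.
  have hiso : IsIso ((induction F).map K.f) := by
    rw [isIso_iff_coyoneda_map_bijective]
    exact fun a => (bijective_precomp_iff (inductionAdjunction F) K.f a).2
      (hF a K.f (isIso_of_mono_of_epi _))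
  have hz : (K.map (induction F)).g = 0 := (hker _ hL).eq_of_tgt _ _
  have : Mono (K.map (induction F)).f := inferInstanceAs (Mono ((induction F).map K.f))
  have hepi : Epi (K.map (induction F)).f := inferInstanceAs (Epi ((induction F).map K.f))
  have : Epi (K.map (induction F)).g :=
    have := hK.epi_g
    inferInstanceAs (Epi ((induction F).map K.g))
  exact { exact := (ShortComplex.exact_iff_epi _ hz).2 hepi }

end Local

/-! ### The test functors `C(I -, X)` into the opposite of abelian groups -/

section LiftedAb

set_option linter.checkUnivs false in
/-- The opposite of the category of abelian groups, with objects lifted to a larger universe. -/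
abbrev LiftedAbOp : Type (max w (v + 1)) :=
  InducedCategory AddCommGrpCat.{v}ᵒᵖ (ULift.down.{w})

/-- The equivalence with the opposite of the category of abelian groups. -/
abbrev LiftedAbOp.down : LiftedAbOp.{v, w} ⥤ AddCommGrpCat.{v}ᵒᵖ :=
  inducedFunctor (ULift.down.{w} : _ → AddCommGrpCat.{v}ᵒᵖ)

instance : (LiftedAbOp.down.{v, w}).EssSurj where
  mem_essImage X := ⟨ULift.up X, ⟨Iso.refl _⟩⟩

instance : (LiftedAbOp.down.{v, w}).IsEquivalence where

instance : HasColimits LiftedAbOp.{v, w} :=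
  Adjunction.has_colimits_of_equivalence LiftedAbOp.down.{v, w}

instance : HasFiniteProducts LiftedAbOp.{v, w} where
  out _ := Adjunction.hasLimitsOfShape_of_equivalence LiftedAbOp.down.{v, w}

instance : Abelian LiftedAbOp.{v, w} := abelianOfEquivalence LiftedAbOp.down.{v, w}

end LiftedAb

section HomOp

variable {G : Type v} [SmallCategory G] [Preadditive G]
variable {C : Type u} [Category.{v} C] [Abelian C]

/-- The functor `g ↦ C(I g, X)`, with values in (a lift of) the opposite of the category of abelian
groups. -/
def homOp (I : G ⥤ C) (X : C) : G ⥤ LiftedAbOp.{v, w} where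
  obj g := ULift.up (op (AddCommGrpCat.of (I.obj g ⟶ X)))
  map f := InducedCategory.homMk
    (AddCommGrpCat.ofHom (Preadditive.leftComp X (I.map f))).op
  map_id g := InducedCategory.hom_ext <| Quiver.Hom.unop_inj <| AddCommGrpCat.hom_ext <|
    AddMonoidHom.ext fun x => (congrArg (· ≫ x) (I.map_id g)).trans (Category.id_comp x)
  map_comp f f' := InducedCategory.hom_ext <| Quiver.Hom.unop_inj <| AddCommGrpCat.hom_ext <|
    AddMonoidHom.ext fun x => (congrArg (· ≫ x) (I.map_comp f f')).trans (Category.assoc _ _ _)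

instance (I : G ⥤ C) [I.Additive] (X : C) : (homOp.{v, w} I X).Additive where
  map_add := InducedCategory.hom_ext <| Quiver.Hom.unop_inj <|
    AddCommGrpCat.hom_ext <| AddMonoidHom.ext fun x =>
      (congrArg (· ≫ x) I.map_add).trans (Preadditive.add_comp _ _ _ _ _ _)

variable [HasColimits C] (I : G ⥤ C) [I.Additive] (X : C)

/-- The group whose opposite is the given object. -/
abbrev LiftedAbOp.group (a : LiftedAbOp.{v, w}) : AddCommGrpCat.{v} := (ULift.down a).unop

/-- Evaluation at an element `s` of the group `a`, as a morphism `F_* a ⟶ I_* X` for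
`F = homOp I X`. -/
def evalHom {a : LiftedAbOp.{v, w}} (s : LiftedAbOp.group a) :
    (restriction (homOp.{v, w} I X)).obj a ⟶ (restriction I).obj X :=
  homOfElt (fun _ t => t.hom.unop s) (fun _ _ _ => rfl) (fun _ _ _ _ => rfl)

variable {I X}

omit [HasColimits C] in
lemma evalHom_ext {a : LiftedAbOp.{v, w}} {M : Mod G}
    {β β' : M ⟶ (restriction (homOp.{v, w} I X)).obj a}
    (h : ∀ s, β ≫ evalHom I X s = β' ≫ evalHom I X s) : β = β' :=
  elt_ext fun g x => InducedCategory.hom_ext <| Quiver.Hom.unop_inj <| AddCommGrpCat.hom_ext <|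
    AddMonoidHom.ext fun s => congrArg (fun γ => elt γ g x) (h s)

omit [HasColimits C] in
lemma evalHom_add {a : LiftedAbOp.{v, w}} (s s' : LiftedAbOp.group a) :
    evalHom I X (s + s') = evalHom I X s + evalHom I X s' :=
  elt_ext fun _ (t : _ ⟶ a) => map_add t.hom.unop.hom s s'

/-- Morphisms to `F_* a`, for `F = homOp I X`, from additive families of morphisms to `I_* X`. -/
def liftEvalHom {a : LiftedAbOp.{v, w}} {M : Mod G}
    (γ : LiftedAbOp.group a →+ (M ⟶ (restriction I).obj X)) :
    M ⟶ (restriction (homOp.{v, w} I X)).obj a :=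
  homOfElt (fun g x => InducedCategory.homMk
    (AddCommGrpCat.ofHom (AddMonoidHom.mk' (fun s => elt (γ s) g x) fun s s' => by
      rw [map_add]; rfl)).op)
    (fun g x y => InducedCategory.hom_ext <| Quiver.Hom.unop_inj <| AddCommGrpCat.hom_ext <|
      AddMonoidHom.ext fun s => elt_add (γ s) x y)
    (fun g g' h x => InducedCategory.hom_ext <| Quiver.Hom.unop_inj <| AddCommGrpCat.hom_ext <|
      AddMonoidHom.ext fun s => elt_map (γ s) h x)

/-- Morphisms `M ⟶ F_* a` are additive maps from the group `a` to `Hom(M, I_* X)`. Thus locality of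
`I_* X`, which holds by adjunction, passes to `F_* a`. -/
theorem isGeneralizedClosed_homOp [AB5 C] [I.Full] [I.Faithful]
    (hI : (ObjectProperty.ofObj I.obj).IsSeparating) (X : C) :
    IsGeneralizedClosed (kerInduction I) (homOp.{v, w} I X) := by
  refine isGeneralizedClosed_of_local hI fun a M N f hf => ?_
  have hb : Function.Bijective (fun β : N ⟶ (restriction I).obj X => f ≫ β) :=
    (bijective_precomp_iff (inductionAdjunction I) f X).1
      ((isIso_iff_coyoneda_map_bijective _).1 hf X)
  refine ⟨fun β β' h => evalHom_ext fun s => hb.1 ?_, fun β => ?_⟩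
  · change f ≫ β = f ≫ β' at h
    change f ≫ β ≫ _ = f ≫ β' ≫ _
    rw [reassoc_of% h]
  · choose γ hγ using fun s => hb.2 (β ≫ evalHom I X s)
    change ∀ s, f ≫ γ s = β ≫ evalHom I X s at hγ
    refine ⟨liftEvalHom (AddMonoidHom.mk' γ fun s s' => hb.1 ?_), evalHom_ext fun s => ?_⟩
    · change f ≫ γ (s + s') = f ≫ (γ s + γ s')
      rw [Preadditive.comp_add, hγ, hγ, hγ, evalHom_add, Preadditive.comp_add]
    · exact (Category.assoc _ _ _).trans (hγ s)

end HomOp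

/-! ### Conditioned epimorphisms give a full restriction functor -/

section Conjugation

/-- The conjugate of a functor by a family of automorphisms. -/
def conjFunctor {G : Type*} [Category* G] {A : Type*} [Category* A] (F : G ⥤ A)
    (e : ∀ g, F.obj g ≅ F.obj g) : G ⥤ A where
  obj := F.obj
  map {g g'} f := (e g).inv ≫ F.map f ≫ (e g').hom

variable {U : Type v} [SmallCategory U] [Preadditive U] {C : Type u} [Category.{v} C] [Abelian C]
variable {T : U ⥤ C} [T.Additive]

omit [Preadditive U] [T.Additive] in
-- Conjugation by `e` fixes objects, and by `he` it fixes the morphisms coming from `U`. So the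
-- conjugate strictly equals `F` after composition with `S`, hence equals `F`.
lemma natural_of_isConditionedEpi {L : ObjectProperty (Mod (Middle T))}
    (hS : IsConditionedEpi.{v, w} L (factorS T)) {A : Type w} [Category.{v} A] [Abelian A]
    [HasColimits A] (F : Middle T ⥤ A) [F.Additive] (hF : IsGeneralizedClosed L F)
    (e : ∀ g, F.obj g ≅ F.obj g)
    (he : ∀ {u u' : U} (f : u ⟶ u'),
      (e u).hom ≫ F.map ((factorS T).map f) = F.map ((factorS T).map f) ≫ (e u').hom)
    {g g' : Middle T} (f : g ⟶ g') : (e g).hom ≫ F.map f = F.map f ≫ (e g').hom := by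
  have : (conjFunctor F e).Additive := ⟨fun {_ _ _ _} => by
    simp only [conjFunctor, F.map_add, Preadditive.add_comp, Preadditive.comp_add]
    rfl⟩
  have h : F = conjFunctor F e := by
    refine hS A F _ hF (CategoryTheory.Functor.ext (fun _ => rfl) fun u u' f => ?_)
    change F.map ((factorS T).map f) =
      𝟙 _ ≫ ((e u).inv ≫ F.map ((factorS T).map f) ≫ (e u').hom) ≫ 𝟙 _
    refine ((Iso.eq_inv_comp _).2 (he f)).trans ?_
    exact ((Category.id_comp _).trans (Category.comp_id _)).symm
  have hf : F.map f = 𝟙 _ ≫ ((e g).inv ≫ F.map f ≫ (e g').hom) ≫ 𝟙 _ := Functor.congr_hom h f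
  exact (Iso.eq_inv_comp _).1 (hf.trans ((Category.id_comp _).trans (Category.comp_id _)))

/-- The transvection of `C(t, c ⊞ c')` given by an additive map `C(t, c) →+ C(t, c')`. -/
def transvection {t c c' : C} (α : (t ⟶ c) →+ (t ⟶ c')) :
    AddCommGrpCat.of (t ⟶ c ⊞ c') ≅ AddCommGrpCat.of (t ⟶ c ⊞ c') where
  hom := AddCommGrpCat.ofHom (AddMonoidHom.mk' (fun h => h + α (h ≫ biprod.fst) ≫ biprod.inr)
    fun x y => by
      simp only [Preadditive.add_comp, map_add]
      abel)
  inv := AddCommGrpCat.ofHom (AddMonoidHom.mk' (fun h => h - α (h ≫ biprod.fst) ≫ biprod.inr)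
    fun x y => by
      simp only [Preadditive.add_comp, map_add]
      abel)
  hom_inv_id := AddCommGrpCat.hom_ext <| AddMonoidHom.ext fun x => by
    change x + _ - α ((x + _) ≫ biprod.fst) ≫ biprod.inr = x
    simp
  inv_hom_id := AddCommGrpCat.hom_ext <| AddMonoidHom.ext fun x => by
    change x - _ + α ((x - _) ≫ biprod.fst) ≫ biprod.inr = x
    simp

theorem restriction_full_of_isConditionedEpi [HasColimits C] [AB5 C] (hI : MiddleGenerates T)
    (hS : IsConditionedEpi.{v, max w (v + 1)} (kerInduction (factorI T)) (factorS T)) :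
    (restriction T).Full where
  map_surjective {c c'} α := by
    let α' (u : U) : (T.obj u ⟶ c) →+ (T.obj u ⟶ c') := (α.hom.app (op u)).hom
    have hα' {u u' : U} (f : u ⟶ u') (x : T.obj u' ⟶ c) : α' u (T.map f ≫ x) = T.map f ≫ α' u' x :=
      elt_map α f x
    -- The lifted target has its objects in the universe over which `hS` quantifies.
    let F := homOp.{v, w} (factorI T) (c ⊞ c')
    -- Conjugation requires automorphisms; the transvection is invertible even if `α' u` is not.
    let e (u : Middle T) : F.obj u ≅ F.obj u := InducedCategory.isoMk (transvection (α' u)).op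
    have he {u u' : U} (f : u ⟶ u') :
        (e u).hom ≫ F.map ((factorS T).map f) = F.map ((factorS T).map f) ≫ (e u').hom :=
      InducedCategory.hom_ext <| Quiver.Hom.unop_inj <| AddCommGrpCat.hom_ext <|
        AddMonoidHom.ext fun (h : T.obj u' ⟶ c ⊞ c') => by
          change T.map f ≫ h + α' u ((T.map f ≫ h) ≫ biprod.fst) ≫ biprod.inr =
            T.map f ≫ (h + α' u' (h ≫ biprod.fst) ≫ biprod.inr)
          rw [Category.assoc, hα', Preadditive.comp_add, Category.assoc]
    have key {u u' : Middle T} (f : u ⟶ u') (x : T.obj u' ⟶ c) :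
        α' u (f.hom ≫ x) = f.hom ≫ α' u' x := by
      -- Naturality of the transvection at `x ≫ biprod.inl`, whose second component is naturality of
      -- `α'`.
      have h : f.hom ≫ x ≫ biprod.inl + α' u ((f.hom ≫ x ≫ biprod.inl) ≫ biprod.fst) ≫ biprod.inr =
          f.hom ≫ (x ≫ biprod.inl + α' u' ((x ≫ biprod.inl) ≫ biprod.fst) ≫
            (biprod.inr : _ ⟶ c ⊞ c')) :=
        congrArg (fun k => k.hom.unop.hom (x ≫ biprod.inl))
          (natural_of_isConditionedEpi hS F (isGeneralizedClosed_homOp hI _) e he f)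
      simpa using h =≫ biprod.snd
    obtain ⟨k, hk⟩ := (restriction_full (F := factorI T) hI).map_surjective
      (homOfElt (M := (restriction (factorI T)).obj c) (fun u x => α' u x)
        (fun u => (α' u).map_add) (fun u u' f x => key f x))
    exact ⟨k, elt_ext fun u x => congrArg
      (fun β : (restriction (factorI T)).obj c ⟶ _ => elt β u x) hk⟩

end Conjugation

end SeveralObjects

end

theorem theorem2p2 {U : Type v} [SmallCategory U] [Preadditive U]
    {C : Type u} [Category.{v} C] [Abelian C] [HasColimits C] [AB5 C]
    (T : U ⥤ C) [T.Additive] :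
    (SeveralObjects.IsGeneralizedLaxEpi T ↔
      SeveralObjects.MiddleGenerates T ∧
      SeveralObjects.IsConditionedEpi.{v, max w (v + 1)}
        (SeveralObjects.kerInduction (SeveralObjects.factorI T)) (SeveralObjects.factorS T)) ∧
    (SeveralObjects.MiddleGenerates T →
      SeveralObjects.IsLocalizing (SeveralObjects.kerInduction (SeveralObjects.factorI T)) ∧
      IsGrothendieckAbelian.{v} C) :=
  ⟨⟨fun h => ⟨SeveralObjects.middleGenerates_of_faithful T h.2,
      SeveralObjects.isConditionedEpi_of_isGeneralizedLaxEpi T h⟩,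
    fun h => ⟨SeveralObjects.restriction_full_of_isConditionedEpi.{v, w} h.1 h.2,
      SeveralObjects.restriction_faithful (F := T) h.1⟩⟩,
    fun h => ⟨SeveralObjects.isLocalizing_kerInduction h,
      SeveralObjects.isGrothendieckAbelian_of_isSeparating h⟩⟩
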